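/- Let $k\in\mathbb{C}$. Write $\log$ for the principal branch of the logarithm, so that for $0<x<1$ one has $\log(\log(x^2))=\log|\log(x^2)|+i\pi$, and put $\log^k(x^2)=e^{k\log(\log(x^2))}$ for $x>0$, $x\neq 1$. The integral $$\int_0^\infty\frac{x\,\log(x)\,\log(\log(x^2))\,\log^k(x^2)}{x^4-1}\,dx$$ converges absolutely if and only if $\operatorname{Re}k>-1$, and for every such $k$ $$\int_{0}^{\infty}\frac{x \log (x)\, \log (\log (x^2))\, \log ^k(x^2)}{x^4-1}\,dx=2^{-k-4}\, e^{\frac{i \pi k}{2}} \Bigl(\bigl((4 \pi)^{k+2}-(2 \pi )^{k+2}\bigr)\, \zeta '(-k-1)+\zeta (k+2) \bigl(i \pi (2^{k+2}-1)+2^{k+3} \log (2 \pi )-2 \log (\pi )\bigr) \cos\bigl(\tfrac{\pi k}{2}\bigr)\, \Gamma (k+2)\Bigr),$$ where $\zeta$ is the (analytically continued) Riemann zeta function, $\zeta'$ its derivative, and $\Gamma$ the Gamma function. -/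

import Mathlib

/-! Substituting `x = exp (t / 2)` gives `∫ t log(t) t^k / (8 sinh t)` over the whole real line. The
half `t > 0` is the Mellin transform of `log t / sinh t` at `s = k + 2`; on `t < 0` the principal
branch adds a factor `e^{iπk}` and an extra `iπ / sinh t` term. The transform of `1 / sinh` is `2(1
- 2^{-s}) Γ(s) ζ(s)` (`mellin_inv_sinh`), and differentiating in `s` inserts the logarithm. The
derivative of `Γζ` is then traded for `ζ'(1 - s)` by differentiating the functional equation. Near
`t = 0` the integrand has size `|t|^{Re k} |log |t||`, whence the threshold `Re k > -1`. -/

/-! ### Mellin transform of `1 / sinh`. -/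

/-- The Dirichlet series over odd integers. -/
theorem hasSum_one_div_odd_cpow {s : ℂ} (hs : 1 < s.re) :
    HasSum (fun n : ℕ ↦ 1 / ((2 * n + 1 : ℝ) : ℂ) ^ s) ((1 - 2 ^ (-s)) * riemannZeta s) := by
  have hsum := Complex.summable_one_div_nat_cpow.2 hs
  have hz : HasSum (fun n : ℕ ↦ 1 / (n : ℂ) ^ s) (riemannZeta s) := by
    rw [zeta_eq_tsum_one_div_nat_cpow hs]
    exact hsum.hasSum
  have he : HasSum (fun n : ℕ ↦ 1 / ((2 * n : ℕ) : ℂ) ^ s) (2 ^ (-s) * riemannZeta s) := by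
    refine (hz.mul_left (2 ^ (-s))).congr_fun ?_
    intro n
    rw [Nat.cast_mul, Complex.natCast_mul_natCast_cpow, Complex.cpow_neg]
    simp only [one_div, mul_inv, Nat.cast_ofNat]
  have hi : Function.Injective (fun n : ℕ ↦ 2 * n + 1) := fun a b h ↦ by simpa using h
  have ho : HasSum (fun n : ℕ ↦ 1 / ((2 * n + 1 : ℕ) : ℂ) ^ s)
      (∑' n : ℕ, 1 / ((2 * n + 1 : ℕ) : ℂ) ^ s) := (hsum.comp_injective hi).hasSum
  have := (HasSum.even_add_odd (f := fun n : ℕ ↦ 1 / (n : ℂ) ^ s) he ho).unique hz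
  have e : (1 - 2 ^ (-s)) * riemannZeta s = ∑' n : ℕ, 1 / ((2 * n + 1 : ℕ) : ℂ) ^ s := by
    linear_combination -this
  rw [e]
  exact ho.congr_fun fun n ↦ by simp

/-- Geometric series: `1 / sinh t = 2 e^{-t} / (1 - e^{-2t})`. -/
theorem hasSum_inv_sinh {t : ℝ} (ht : 0 < t) :
    HasSum (fun n : ℕ ↦ (2 : ℂ) * (Real.exp (-(2 * n + 1) * t) : ℝ)) ((Real.sinh t : ℝ) : ℂ)⁻¹ := by
  have hq : Real.exp (-2 * t) < 1 := by rw [Real.exp_lt_one_iff]; linarith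
  have h := (hasSum_geometric_of_lt_one (Real.exp_pos _).le hq).mul_left (2 * Real.exp (-t))
  have h2 : (2 * Real.exp (-t)) * (1 - Real.exp (-2 * t))⁻¹ = (Real.sinh t)⁻¹ := by
    have e : Real.exp (-2 * t) = Real.exp (-t) * Real.exp (-t) := by
      rw [← Real.exp_add]; ring_nf
    have e1 : Real.exp t * Real.exp (-t) = 1 := by rw [← Real.exp_add]; simp
    rw [← div_eq_mul_inv, ← one_div, div_eq_div_iff (by linarith) (Real.sinh_pos_iff.2 ht).ne',
      Real.sinh_eq, e]
    linear_combination e1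
  rw [h2] at h
  rw [← Complex.ofReal_inv]
  refine (Complex.hasSum_ofReal.2 h).congr_fun ?_
  intro n
  rw [← Real.exp_nat_mul, mul_assoc, ← Real.exp_add]
  push_cast
  ring_nf

theorem mellin_inv_sinh {s : ℂ} (hs : 1 < s.re) :
    mellin (fun t : ℝ ↦ ((Real.sinh t : ℝ) : ℂ)⁻¹) s
      = 2 * (1 - 2 ^ (-s)) * (Complex.Gamma s * riemannZeta s) := by
  have h1 := hasSum_mellin (a := fun _ : ℕ ↦ (2 : ℂ)) (p := fun n : ℕ ↦ (2 * n + 1 : ℝ))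
    (F := fun t : ℝ ↦ ((Real.sinh t : ℝ) : ℂ)⁻¹) (s := s) (fun n ↦ Or.inr (by positivity))
    (by linarith) (fun t ht ↦ hasSum_inv_sinh ht) ?_
  · have h2 := (hasSum_one_div_odd_cpow hs).mul_left (2 * Complex.Gamma s)
    refine (h1.unique (h2.congr_fun fun n ↦ ?_)).trans (by ring)
    ring
  · have := ((hasSum_one_div_odd_cpow hs).summable.norm).mul_left 2
    refine this.congr fun n ↦ ?_
    rw [norm_div, Complex.norm_cpow_eq_rpow_re_of_pos (by positivity)]
    simp [div_eq_mul_inv]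

-- `1 / sinh t` is `O(1/t)` at `0` and decays exponentially at infinity, so its Mellin transform may
-- be differentiated under the integral for `Re s > 1`.
open MeasureTheory Filter Asymptotics in
theorem mellin_inv_sinh_hasDerivAt {s : ℂ} (hs : 1 < s.re) :
    MellinConvergent (fun t : ℝ ↦ Real.log t • ((Real.sinh t : ℝ) : ℂ)⁻¹) s ∧
      HasDerivAt (mellin (fun t : ℝ ↦ ((Real.sinh t : ℝ) : ℂ)⁻¹))
        (mellin (fun t : ℝ ↦ Real.log t • ((Real.sinh t : ℝ) : ℂ)⁻¹) s) s ∧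
      MellinConvergent (fun t : ℝ ↦ ((Real.sinh t : ℝ) : ℂ)⁻¹) s := by
  have hc : LocallyIntegrableOn (fun t : ℝ ↦ ((Real.sinh t : ℝ) : ℂ)⁻¹) (Set.Ioi 0) := by
    refine ContinuousOn.locallyIntegrableOn ?_ measurableSet_Ioi
    refine ContinuousOn.inv₀ (by fun_prop) fun t ht ↦ ?_
    exact_mod_cast (Real.sinh_pos_iff.2 ht).ne'
  have ht : (fun t : ℝ ↦ ((Real.sinh t : ℝ) : ℂ)⁻¹) =O[atTop] (· ^ (-(s.re + 1))) := by
    refine IsBigO.trans ?_ (isLittleO_exp_neg_mul_rpow_atTop one_pos _).isBigO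
    refine IsBigO.of_bound 4 ((eventually_ge_atTop 1).mono fun t ht ↦ ?_)
    have h1 : Real.exp (-t) ≤ 1 := Real.exp_le_one_iff.2 (by linarith)
    have h2 : 2 ≤ Real.exp t := by linarith [Real.add_one_le_exp t]
    have h3 : Real.exp t ≤ 4 * Real.sinh t := by rw [Real.sinh_eq]; linarith
    have h4 : 0 < Real.sinh t := Real.sinh_pos_iff.2 (by linarith)
    rw [norm_inv, Complex.norm_real, Real.norm_of_nonneg h4.le,
      Real.norm_of_nonneg (Real.exp_pos _).le, neg_one_mul, Real.exp_neg, ← div_eq_mul_inv,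
      inv_eq_one_div, div_le_div_iff₀ h4 (Real.exp_pos t)]
    linarith
  have hb : (fun t : ℝ ↦ ((Real.sinh t : ℝ) : ℂ)⁻¹) =O[nhdsWithin 0 (Set.Ioi 0)]
      (· ^ (-(1 : ℝ))) := by
    refine IsBigO.of_bound 1 (eventually_mem_nhdsWithin.mono fun t (ht : 0 < t) ↦ ?_)
    have h4 : 0 < Real.sinh t := Real.sinh_pos_iff.2 ht
    rw [norm_inv, Complex.norm_real, Real.norm_of_nonneg h4.le, Real.rpow_neg_one, norm_inv,
      Real.norm_of_nonneg ht.le, one_mul]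
    exact inv_anti₀ ht (Real.self_le_sinh_iff.2 ht.le)
  obtain ⟨h1, h2⟩ := mellin_hasDerivAt_of_isBigO_rpow hc ht (by linarith) hb hs
  exact ⟨h1, h2, mellinConvergent_of_isBigO_rpow hc ht (by linarith) hb hs⟩

/-! ### Substitution and convergence. -/

/-- The integrand after the substitution `x = exp (t / 2)`. -/
noncomputable def logIntegrand (k : ℂ) (t : ℝ) : ℂ :=
  (t * Complex.log t * (t : ℂ) ^ k) * ((Real.sinh t : ℝ) : ℂ)⁻¹ / 8

/-- With `x = e^{t/2}`, `x^4 - 1 = 2 x^2 sinh t`. No exception is needed at `t = 0`, where both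
sides are `0`. -/
theorem exp_smul_eq_logIntegrand (k : ℂ) (t : ℝ) :
    |Real.exp (t / 2) / 2| • (fun x : ℝ ↦ (x : ℂ) * (Real.log x : ℂ)
      * Complex.log ((Real.log (x ^ 2) : ℝ) : ℂ)
      * ((Real.log (x ^ 2) : ℝ) : ℂ) ^ k / ((x : ℂ) ^ 4 - 1)) (Real.exp (t / 2))
      = logIntegrand k t := by
  have h0 : 0 < Real.exp (t / 2) := Real.exp_pos _
  have h1 : Real.log (Real.exp (t / 2) ^ 2) = t := by rw [Real.log_pow, Real.log_exp]; simp; ring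
  have h2 : ((Real.exp (t / 2) : ℝ) : ℂ) ^ 4 - 1
      = ((Real.exp (t / 2) : ℝ) : ℂ) ^ 2 * (2 * ((Real.sinh t : ℝ) : ℂ)) := by
    norm_cast
    have e : Real.exp t = Real.exp (t / 2) ^ 2 := by rw [← Real.exp_nat_mul]; ring_nf
    rw [Real.sinh_eq, Real.exp_neg, e]
    field_simp
  simp only [logIntegrand, h1, h2, Real.log_exp, abs_of_pos (half_pos h0), Complex.real_smul]
  have h3 : ((Real.exp (t / 2) : ℝ) : ℂ) ≠ 0 := by exact_mod_cast h0.ne'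
  rw [Complex.ofReal_div, Complex.ofReal_div]
  generalize ((Real.exp (t / 2) : ℝ) : ℂ) = X at *
  rw [div_eq_mul_inv _ (X ^ 2 * _), mul_inv, mul_inv]
  generalize ((Real.sinh t : ℝ) : ℂ)⁻¹ = Y
  push_cast
  field_simp
  ring

theorem logIntegrand_of_pos (k : ℂ) {t : ℝ} (ht : 0 < t) :
    logIntegrand k t
      = ((t : ℂ) ^ (k + 2 - 1) • (Real.log t • ((Real.sinh t : ℝ) : ℂ)⁻¹)) / 8 := by
  have h : (t : ℂ) ≠ 0 := by exact_mod_cast ht.ne'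
  have e : (t : ℂ) ^ (k + 2 - 1) = t ^ k * t := by
    rw [show k + 2 - 1 = k + 1 by ring, Complex.cpow_add _ _ h, Complex.cpow_one]
  rw [e, logIntegrand, ← Complex.ofReal_log ht.le, Complex.real_smul, smul_eq_mul]
  ring

/-- The signs of `t` and `sinh t` cancel, so only the branch contributes. -/
theorem logIntegrand_neg (k : ℂ) {t : ℝ} (ht : 0 < t) :
    logIntegrand k (-t) = Complex.exp (Complex.I * Real.pi * k) / 8 *
      ((t : ℂ) ^ (k + 2 - 1) • (Real.log t • ((Real.sinh t : ℝ) : ℂ)⁻¹)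
        + Complex.I * Real.pi * ((t : ℂ) ^ (k + 2 - 1) • ((Real.sinh t : ℝ) : ℂ)⁻¹)) := by
  have h : (t : ℂ) ≠ 0 := by exact_mod_cast ht.ne'
  have e : (t : ℂ) ^ (k + 2 - 1) = t ^ k * t := by
    rw [show k + 2 - 1 = k + 1 by ring, Complex.cpow_add _ _ h, Complex.cpow_one]
  have hp : ((-t : ℝ) : ℂ) ^ k = t ^ k * Complex.exp (Complex.I * Real.pi * k) := by
    rw [Complex.ofReal_cpow_of_nonpos (by linarith)]
    push_cast
    rw [neg_neg]
    ring_nf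
  have hl : Complex.log ((-t : ℝ) : ℂ) = Real.log t + Complex.I * Real.pi := by
    rw [Complex.log, Complex.arg_ofReal_of_neg (by linarith), Complex.norm_real, norm_neg,
      Real.norm_of_nonneg ht.le, mul_comm]
  rw [e, logIntegrand, hp, hl, Real.sinh_neg, Complex.real_smul, smul_eq_mul, smul_eq_mul]
  push_cast
  rw [inv_neg]
  ring

theorem hasDerivAt_exp_half (t : ℝ) :
    HasDerivAt (fun t : ℝ ↦ Real.exp (t / 2)) (Real.exp (t / 2) / 2) t := by
  simpa [div_eq_mul_inv] using ((hasDerivAt_id t).div_const 2).exp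

open MeasureTheory Set in
theorem image_exp_half_univ : (fun t : ℝ ↦ Real.exp (t / 2)) '' univ = Ioi 0 := by
  ext x
  simp only [image_univ, mem_range, mem_Ioi]
  refine ⟨fun ⟨t, ht⟩ ↦ ht ▸ Real.exp_pos _, fun hx ↦ ⟨2 * Real.log x, ?_⟩⟩
  rw [mul_div_cancel_left₀ _ two_ne_zero, Real.exp_log hx]

open MeasureTheory Set in
theorem neg_one_lt_re_of_integrableOn_logIntegrand {k : ℂ}
    (h : IntegrableOn (logIntegrand k) (Ioi 0)) :
    -1 < k.re := by
  have hpos : (0 : ℝ) < Real.exp (-1) := Real.exp_pos _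
  have hle : Real.exp (-1) ≤ 1 := Real.exp_le_one_iff.2 (by norm_num)
  rw [← intervalIntegral.integrableOn_Ioo_rpow_iff hpos]
  have h' : IntegrableOn (logIntegrand k) (Ioo 0 (Real.exp (-1))) :=
    h.mono_set Ioo_subset_Ioi_self
  -- On `(0, 1/e)`, `|log t| ≥ 1` and `t / sinh t ≥ 1/2`; with the factor `1/8` this gives `16`.
  refine (h'.norm.const_mul 16).mono' (by fun_prop) ?_
  refine (ae_restrict_iff' measurableSet_Ioo).2 (Filter.Eventually.of_forall fun t ht ↦ ?_)
  have h4 : 0 < Real.sinh t := Real.sinh_pos_iff.2 ht.1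
  have h1 : 1 ≤ |Real.log t| := by
    have := (Real.log_lt_iff_lt_exp ht.1).2 ht.2
    rw [abs_of_neg (by linarith)]
    linarith
  have h2 : Real.sinh t ≤ 2 * t := by
    have a := abs_le.1 (Real.abs_exp_sub_one_sub_id_le (x := t)
      (by rw [abs_of_pos ht.1]; linarith [ht.2]))
    have b := Real.add_one_le_exp (-t)
    have c : t ^ 2 ≤ t := by nlinarith [ht.1, ht.2]
    rw [Real.sinh_eq]
    linarith [ht.1]
  have hk : 0 < t ^ k.re := Real.rpow_pos_of_pos ht.1 _
  rw [Real.norm_of_nonneg hk.le, logIntegrand, ← Complex.ofReal_log ht.1.le]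
  simp only [norm_div, norm_mul, norm_inv, Complex.norm_real,
    Complex.norm_cpow_eq_rpow_re_of_pos ht.1, Real.norm_eq_abs, abs_of_pos ht.1, abs_of_pos h4]
  have h5 : 1 ≤ 2 * t * (Real.sinh t)⁻¹ := by
    rw [← div_eq_mul_inv, le_div_iff₀ h4]
    linarith
  calc t ^ k.re = 1 * 1 * t ^ k.re := by ring
    _ ≤ |Real.log t| * (2 * t * (Real.sinh t)⁻¹) * t ^ k.re := by gcongr
    _ = _ := by norm_num; ring

open MeasureTheory Set in
theorem integrableOn_iff_integrable_logIntegrand (k : ℂ) :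
    IntegrableOn (fun x : ℝ ↦ (x : ℂ) * (Real.log x : ℂ)
      * Complex.log ((Real.log (x ^ 2) : ℝ) : ℂ)
      * ((Real.log (x ^ 2) : ℝ) : ℂ) ^ k / ((x : ℂ) ^ 4 - 1)) (Ioi 0) ↔
      Integrable (logIntegrand k) := by
  rw [← image_exp_half_univ, integrableOn_image_iff_integrableOn_abs_deriv_smul
    (f' := fun t ↦ Real.exp (t / 2) / 2) MeasurableSet.univ
    (fun t _ ↦ ?_) (fun x _ y _ hxy ↦ ?_)]
  · simp_rw [exp_smul_eq_logIntegrand, integrableOn_univ]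
  · exact hasDerivAt_exp_half t |>.hasDerivWithinAt
  · have := Real.exp_injective hxy
    linarith

open MeasureTheory Set in
theorem integral_eq_integral_logIntegrand (k : ℂ) :
    ∫ x in Ioi (0 : ℝ), (x : ℂ) * (Real.log x : ℂ)
      * Complex.log ((Real.log (x ^ 2) : ℝ) : ℂ)
      * ((Real.log (x ^ 2) : ℝ) : ℂ) ^ k / ((x : ℂ) ^ 4 - 1) = ∫ t, logIntegrand k t := by
  rw [← image_exp_half_univ, integral_image_eq_integral_abs_deriv_smul
    (f' := fun t ↦ Real.exp (t / 2) / 2) MeasurableSet.univ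
    (fun t _ ↦ ?_) (fun x _ y _ hxy ↦ ?_)]
  · simp_rw [exp_smul_eq_logIntegrand]
    simp
  · exact hasDerivAt_exp_half t |>.hasDerivWithinAt
  · have := Real.exp_injective hxy
    linarith

open MeasureTheory Set in
theorem integral_logIntegrand {k : ℂ} (hk : -1 < k.re) :
    Integrable (logIntegrand k) ∧ ∫ t, logIntegrand k t =
      mellin (fun t : ℝ ↦ Real.log t • ((Real.sinh t : ℝ) : ℂ)⁻¹) (k + 2) / 8
      + Complex.exp (Complex.I * Real.pi * k) / 8 *
      (mellin (fun t : ℝ ↦ Real.log t • ((Real.sinh t : ℝ) : ℂ)⁻¹) (k + 2)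
        + Complex.I * Real.pi * mellin (fun t : ℝ ↦ ((Real.sinh t : ℝ) : ℂ)⁻¹) (k + 2)) := by
  obtain ⟨h1, -, h2⟩ := mellin_inv_sinh_hasDerivAt (s := k + 2) (by simp; linarith)
  have hp : IntegrableOn (logIntegrand k) (Ioi 0) :=
    (integrableOn_congr_fun (fun t ht ↦ logIntegrand_of_pos k ht) measurableSet_Ioi).2
      (Integrable.div_const h1 8)
  have hn : IntegrableOn (fun t ↦ logIntegrand k (-t)) (Ioi 0) :=
    (integrableOn_congr_fun (fun t ht ↦ logIntegrand_neg k ht) measurableSet_Ioi).2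
      ((Integrable.add h1 (Integrable.const_mul h2 (Complex.I * Real.pi))).const_mul _)
  have hn' : IntegrableOn (logIntegrand k) (Iic 0) := by
    rw [integrableOn_Iic_iff_integrableOn_Iio]
    have := IntegrableOn.comp_neg_Iio (c := 0) (f := fun t ↦ logIntegrand k (-t))
      (μ := volume) (by simpa using hn)
    simpa using this
  refine ⟨by rw [← integrableOn_univ, ← Iic_union_Ioi (a := (0 : ℝ))]; exact hn'.union hp, ?_⟩
  rw [← setIntegral_univ, ← Iic_union_Ioi (a := (0 : ℝ)),
    setIntegral_union (Iic_disjoint_Ioi le_rfl) measurableSet_Ioi hn' hp, add_comm]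
  congr 1
  · rw [setIntegral_congr_fun measurableSet_Ioi (fun t ht ↦ logIntegrand_of_pos k ht),
      integral_div, mellin]
  · have := integral_comp_neg_Ioi 0 (logIntegrand k)
    rw [neg_zero] at this
    rw [← this, setIntegral_congr_fun measurableSet_Ioi (fun t ht ↦ logIntegrand_neg k ht),
      integral_const_mul, integral_add h1 (Integrable.const_mul h2 _), integral_const_mul,
      mellin, mellin]

/-! ### Derivatives of the functional equation and of the Mellin transform. -/

open Complex in
/-- The derivative of the functional equation of the Riemann zeta function. -/
theorem deriv_riemannZeta_one_sub {s G' : ℂ} (hs : 1 < s.re)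
    (hG : HasDerivAt (fun z ↦ Gamma z * riemannZeta z) G' s) :
    (2 * Real.pi : ℂ) ^ s * deriv riemannZeta (1 - s)
      = 2 * (Real.log (2 * Real.pi) * cos (Real.pi * s / 2) * (Gamma s * riemannZeta s)
        + Real.pi / 2 * sin (Real.pi * s / 2) * (Gamma s * riemannZeta s)
        - cos (Real.pi * s / 2) * G') := by
  have hpi : (2 * Real.pi : ℂ) ≠ 0 := by simp [Real.pi_ne_zero]
  have hne : (1 - s) ≠ 1 := by
    intro h
    have : s = 0 := by linear_combination -h
    simp [this] at hs
    linarith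
  have h1 : HasDerivAt (fun z ↦ riemannZeta (1 - z)) (deriv riemannZeta (1 - s) * (-1)) s :=
    (differentiableAt_riemannZeta hne).hasDerivAt.comp s ((hasDerivAt_id s).const_sub 1)
  have h2 : HasDerivAt (fun z : ℂ ↦ (2 * Real.pi : ℂ) ^ (-z))
      ((2 * Real.pi : ℂ) ^ (-s) * Complex.log (2 * Real.pi) * (-1)) s :=
    (hasDerivAt_neg s).const_cpow (Or.inl hpi)
  have h3 : HasDerivAt (fun z : ℂ ↦ cos (Real.pi * z / 2))
      (-sin (Real.pi * s / 2) * (Real.pi * 1 / 2)) s :=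
    (((hasDerivAt_id s).const_mul _).div_const 2).ccos
  have h4 := (h2.const_mul 2).mul (h3.mul hG)
  have h5 := h1.unique (h4.congr_of_eventuallyEq ?_)
  · have e : (2 * Real.pi : ℂ) ^ (-s) * (2 * Real.pi : ℂ) ^ s = 1 := by
      rw [← cpow_add _ _ hpi]; simp
    have el : Complex.log (2 * Real.pi) = Real.log (2 * Real.pi) := by
      rw [Complex.ofReal_log (by positivity)]; push_cast; rfl
    rw [el] at h5
    simp only [Pi.mul_apply] at h5
    generalize (2 * Real.pi : ℂ) ^ s = A at *
    generalize (2 * Real.pi : ℂ) ^ (-s) = B at *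
    linear_combination (-A) * h5 + 2 * (Real.log (2 * Real.pi) * cos (Real.pi * s / 2)
      * (Gamma s * riemannZeta s) + Real.pi / 2 * sin (Real.pi * s / 2)
      * (Gamma s * riemannZeta s) - cos (Real.pi * s / 2) * G') * e
  · filter_upwards [(isOpen_lt continuous_const continuous_re).mem_nhds hs] with z hz
    have hz : 1 < z.re := hz
    rw [riemannZeta_one_sub]
    · simp only [Pi.mul_apply]
      ring
    · rintro n rfl
      simp at hz
      linarith [n.cast_nonneg (α := ℝ)]
    · rintro rfl
      simp at hz

open Complex in
theorem mellin_log_inv_sinh {s G' : ℂ} (hs : 1 < s.re)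
    (hG : HasDerivAt (fun z ↦ Gamma z * riemannZeta z) G' s) :
    mellin (fun t : ℝ ↦ Real.log t • ((Real.sinh t : ℝ) : ℂ)⁻¹) s
      = 2 * (2 ^ (-s) * Real.log 2 * (Gamma s * riemannZeta s) + (1 - 2 ^ (-s)) * G') := by
  have h2 : HasDerivAt (fun z : ℂ ↦ 2 * (1 - (2 : ℂ) ^ (-z)))
      (2 * -((2 : ℂ) ^ (-s) * Complex.log 2 * (-1))) s :=
    (((hasDerivAt_neg s).const_cpow (Or.inl two_ne_zero)).const_sub 1).const_mul 2
  have h := (mellin_inv_sinh_hasDerivAt hs).2.1.unique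
    ((h2.mul hG).congr_of_eventuallyEq ?_)
  · rw [h, Complex.ofReal_log zero_le_two]
    push_cast
    ring
  · filter_upwards [(isOpen_lt continuous_const continuous_re).mem_nhds hs] with z hz
    exact mellin_inv_sinh hz

/-! ### Assembly. -/

theorem mainTheorem10 (k : ℂ) :
    (MeasureTheory.IntegrableOn
        (fun x : ℝ =>
          (x : ℂ) * (Real.log x : ℂ) * Complex.log ((Real.log (x ^ 2) : ℝ) : ℂ)
            * ((Real.log (x ^ 2) : ℝ) : ℂ) ^ k / ((x : ℂ) ^ 4 - 1))
        (Set.Ioi (0 : ℝ)) MeasureTheory.volume ↔ -1 < k.re) ∧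
    (-1 < k.re →
      ∫ x in Set.Ioi (0 : ℝ),
          (x : ℂ) * (Real.log x : ℂ) * Complex.log ((Real.log (x ^ 2) : ℝ) : ℂ)
            * ((Real.log (x ^ 2) : ℝ) : ℂ) ^ k / ((x : ℂ) ^ 4 - 1)
        = (2 : ℂ) ^ (-k - 4) * Complex.exp (Complex.I * (Real.pi : ℂ) * k / 2)
          * (((4 * (Real.pi : ℂ)) ^ (k + 2) - (2 * (Real.pi : ℂ)) ^ (k + 2))
                * deriv riemannZeta (-k - 1)
              + riemannZeta (k + 2)
                * (Complex.I * (Real.pi : ℂ) * ((2 : ℂ) ^ (k + 2) - 1)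
                    + (2 : ℂ) ^ (k + 3) * (Real.log (2 * Real.pi) : ℂ)
                    - 2 * (Real.log Real.pi : ℂ))
                * Complex.cos ((Real.pi : ℂ) * k / 2) * Complex.Gamma (k + 2))) := by
  rw [integrableOn_iff_integrable_logIntegrand, integral_eq_integral_logIntegrand]
  refine ⟨⟨fun h ↦ neg_one_lt_re_of_integrableOn_logIntegrand h.integrableOn,
    fun h ↦ (integral_logIntegrand h).1⟩, fun hk ↦ ?_⟩
  rw [(integral_logIntegrand hk).2]
  have hs : 1 < (k + 2).re := by simp; linarith
  have hG : DifferentiableAt ℂ (fun z ↦ Complex.Gamma z * riemannZeta z) (k + 2) := by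
    refine (Complex.differentiableAt_Gamma _ fun n h ↦ ?_).mul
      (differentiableAt_riemannZeta fun h ↦ ?_)
    · rw [h] at hs
      simp at hs
      linarith [n.cast_nonneg (α := ℝ)]
    · simp [h] at hs
  obtain ⟨G', hG⟩ : ∃ G', HasDerivAt _ G' _ := ⟨_, hG.hasDerivAt⟩
  have hD := deriv_riemannZeta_one_sub hs hG
  rw [mellin_log_inv_sinh hs hG, mellin_inv_sinh hs]
  have ek : -k - 1 = 1 - (k + 2) := by ring
  have e1 : (2 : ℂ) ^ (-k - 4) = 2 ^ (-(k + 2)) / 4 := by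
    rw [show -k - 4 = -(k + 2) - 2 by ring, Complex.cpow_sub _ _ two_ne_zero]
    norm_num
  have e2 : (2 : ℂ) ^ (k + 3) = 2 ^ (k + 2) * 2 := by
    rw [show k + 3 = (k + 2) + 1 by ring, Complex.cpow_add _ _ two_ne_zero, Complex.cpow_one]
  have e3 : (4 * (Real.pi : ℂ)) ^ (k + 2) = 2 ^ (k + 2) * (2 * (Real.pi : ℂ)) ^ (k + 2) := by
    have := Complex.mul_cpow_ofReal_nonneg (a := 2) (b := 2 * Real.pi) zero_le_two
      (by positivity) (k + 2)
    push_cast at this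
    rw [← this]
    ring_nf
  have e4 : (2 : ℂ) ^ (-(k + 2)) * 2 ^ (k + 2) = 1 := by
    rw [← Complex.cpow_add _ _ two_ne_zero]
    simp
  have e5 : Complex.exp (Complex.I * Real.pi * k)
      = Complex.exp (Complex.I * Real.pi * k / 2) ^ 2 := by
    rw [← Complex.exp_nat_mul]
    ring_nf
  have e6 : Complex.exp (Complex.I * Real.pi * k / 2)
      = Complex.cos (Real.pi * k / 2) + Complex.sin (Real.pi * k / 2) * Complex.I := by
    rw [← Complex.exp_mul_I]
    ring_nf
  have e7 : Complex.cos (Real.pi * (k + 2) / 2) = -Complex.cos (Real.pi * k / 2) := by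
    rw [← Complex.cos_add_pi]
    ring_nf
  have e8 : Complex.sin (Real.pi * (k + 2) / 2) = -Complex.sin (Real.pi * k / 2) := by
    rw [← Complex.sin_add_pi]
    ring_nf
  have e9 : (Real.log (2 * Real.pi) : ℂ) = Real.log 2 + Real.log Real.pi := by
    rw [Real.log_mul two_ne_zero Real.pi_ne_zero, Complex.ofReal_add]
  have e10 := Complex.sin_sq_add_cos_sq (Real.pi * k / 2)
  have eI := Complex.I_sq
  rw [e7, e8, e9] at hD
  rw [ek, e1, e2, e3, e5, e9]
  -- The cosine produced here matches the factor of `G'` in `hD`, so `G'` is eliminated without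
  -- dividing by a cosine that may vanish.
  have e11 : 1 + Complex.exp (Complex.I * Real.pi * k / 2) ^ 2
      = 2 * Complex.cos (Real.pi * k / 2) * Complex.exp (Complex.I * Real.pi * k / 2) := by
    rw [e6]
    linear_combination Complex.sin (Real.pi * k / 2) ^ 2 * eI - e10
  -- With transcendental values made into atoms, a polynomial identity modulo `hD`, `e4`, `e6`,
  -- `e11` and `eI` remains.
  generalize (2 * (Real.pi : ℂ)) ^ (k + 2) = A at *
  generalize deriv riemannZeta (1 - (k + 2)) = Z at *
  generalize (2 : ℂ) ^ (k + 2) = P at *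
  generalize (2 : ℂ) ^ (-(k + 2)) = Q at *
  generalize Complex.exp (Complex.I * Real.pi * k / 2) = E at *
  generalize Complex.cos (Real.pi * k / 2) = c at *
  generalize Complex.sin (Real.pi * k / 2) = σ at *
  generalize Complex.Gamma (k + 2) = g at *
  generalize riemannZeta (k + 2) = z at *
  generalize (Real.log 2 : ℂ) = l at *
  generalize (Real.log Real.pi : ℂ) = m at *
  generalize (Real.pi : ℂ) = π at *
  generalize Complex.I = i at *
  have eQ : Q * (P - 1) = 1 - Q := by linear_combination e4
  calc _ = (1 + E ^ 2) * (2 * (Q * l * (g * z) + (1 - Q) * G')) / 8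
        + E ^ 2 * i * π * (1 - Q) * (g * z) / 4 := by ring
    -- One factor of `E ^ 2` is expanded as `c + σ * i` to expose the sine term of `hD`.
    _ = 2 * c * E * (2 * (Q * l * (g * z) + (1 - Q) * G')) / 8
        + E * (c + σ * i) * i * π * (1 - Q) * (g * z) / 4 := by
      rw [e11]
      linear_combination E * i * π * (1 - Q) * (g * z) / 4 * e6
    _ = _ := by
      linear_combination (-Q / 4 * E * (P - 1)) * hD
        + E * σ * π * (1 - Q) * (g * z) / 4 * eI
        - E / 4 * (2 * c * G' - π * σ * g * z + c * g * z * i * π) * eQ
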